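/- For $t>0$ let $H_t$ be the Hölder mean of order $t$, i.e. the bounded operator on the complex Hilbert space $L^2(\mathbb{R})$ given for almost every $x\in\mathbb{R}$ by $$ (H_t f)(x)=\frac{1}{\Gamma(t)}\int_0^1\Bigl(\log\frac1u\Bigr)^{t-1}f(ux)\,du , $$ and put $H_0:=I$. Then the family $T(t)=2^{-t}H_t$ $(t\ge 0)$ is a strongly continuous one-parameter semigroup of bounded operators on $L^2(\mathbb{R})$ (that is, $T(0)=I$, $T(s+t)=T(s)T(t)$ for all $s,t\ge 0$, and $t\mapsto T(t)f$ is continuous on $[0,\infty)$ for every $f\in L^2(\mathbb{R})$), and it is uniformly stable in the sense that $$ \lim_{t\to+\infty}2^{-t}\,\|H_t f\|_{L^2(\mathbb{R})}=0\qquad\text{for all } f\in L^2(\mathbb{R}). $$ -/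

import Mathlib

open MeasureTheory Filter Set
open scoped ENNReal Topology

noncomputable section

namespace HolderMeans

/-- The Hilbert space of (classes of) square integrable complex functions on the real line. -/
abbrev L2R : Type := Lp ℂ 2 (volume : Measure ℝ)

/-- The weight of the Hölder mean of order `t`, without the factor `1 / Γ(t)`. -/
def weight (t u : ℝ) : ℝ := Real.log (1 / u) ^ (t - 1)

/-- The Hölder mean of order `t` of a function `f`, as a function of `x`:
`(1 / Γ(t)) ∫₀¹ (log (1/u))^(t-1) f(u x) du`. -/
def holderMean (t : ℝ) (f : ℝ → ℂ) (x : ℝ) : ℂ :=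
  (1 / Real.Gamma t) • ∫ u in Ioo (0 : ℝ) 1, weight t u • f (u * x)

/-- The integral bounding the norm of the operator. -/
def mass (t : ℝ) : ℝ≥0∞ :=
  ∫⁻ u in Ioo (0 : ℝ) 1, ENNReal.ofReal (weight t u * u ^ (-(1 / 2) : ℝ))

theorem weight_nonneg {t u : ℝ} (hu : u ∈ Ioo (0 : ℝ) 1) : 0 ≤ weight t u := by
  apply Real.rpow_nonneg
  apply Real.log_nonneg
  rw [le_div_iff₀ hu.1]
  linarith [hu.2]

theorem measurable_weight (t : ℝ) : Measurable (weight t) := by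
  unfold weight
  fun_prop

theorem integrableOn_weight {t : ℝ} (ht : 0 < t) :
    IntegrableOn (fun u => weight t u * u ^ (-(1 / 2) : ℝ)) (Ioo 0 1) := by
  have himg : (fun v : ℝ => Real.exp (-v)) '' Ioi 0 = Ioo 0 1 := by
    ext u
    constructor
    · rintro ⟨v, hv, rfl⟩
      exact ⟨Real.exp_pos _, by simpa using hv⟩
    · intro hu
      refine ⟨-Real.log u, ?_, ?_⟩
      · simpa using Real.log_neg hu.1 hu.2
      · simp [Real.exp_log hu.1]
  rw [← himg, integrableOn_image_iff_integrableOn_abs_deriv_smul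
    (f' := fun v => -Real.exp (-v)) measurableSet_Ioi
    (fun v _ => by
      have := ((hasDerivAt_id v).neg.exp).hasDerivWithinAt (s := Ioi (0 : ℝ))
      simpa using this)
    (fun a _ b _ h => by simpa using h)]
  have := integrableOn_rpow_mul_exp_neg_mul_rpow (s := t - 1) (p := 1) (b := 1 / 2)
    (by linarith) one_pos (by norm_num)
  refine this.congr_fun (fun v hv => ?_) measurableSet_Ioi
  simp only [weight, smul_eq_mul, abs_neg, abs_of_pos (Real.exp_pos _), Real.rpow_one,
    one_div, ← Real.exp_neg, neg_neg, Real.log_exp]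
  rw [← Real.exp_mul, mul_left_comm, ← Real.exp_add]
  ring_nf

theorem mass_lt_top {t : ℝ} (ht : 0 < t) : mass t < ∞ := by
  have h := (integrableOn_weight ht).lintegral_lt_top
  exact h

/-- Cauchy-Schwarz for the absolute Hölder mean. -/
theorem lintegral_sq_le (t : ℝ) {g : ℝ → ℝ≥0∞} (hg : Measurable g) :
    ∫⁻ x, (∫⁻ u in Ioo (0 : ℝ) 1, ENNReal.ofReal (weight t u) * g (u * x)) ^ (2 : ℝ)
      ≤ mass t ^ (2 : ℝ) * ∫⁻ x, g x ^ (2 : ℝ) := by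
  have hw := measurable_weight t
  have hpt : ∀ x, (∫⁻ u in Ioo (0 : ℝ) 1, ENNReal.ofReal (weight t u) * g (u * x)) ^ (2 : ℝ)
      ≤ mass t * ∫⁻ u in Ioo (0 : ℝ) 1,
        ENNReal.ofReal (weight t u * u ^ (1 / 2 : ℝ)) * g (u * x) ^ (2 : ℝ) := by
    intro x
    have hcs := ENNReal.lintegral_mul_le_Lp_mul_Lq (volume.restrict (Ioo (0 : ℝ) 1))
      Real.HolderConjugate.two_two
      (f := fun u => ENNReal.ofReal (weight t u * u ^ (-(1 / 2) : ℝ)) ^ (1 / 2 : ℝ))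
      (g := fun u => ENNReal.ofReal (weight t u * u ^ (1 / 2 : ℝ)) ^ (1 / 2 : ℝ) * g (u * x))
      (by fun_prop) (by fun_prop)
    have hl : ∫⁻ u in Ioo (0 : ℝ) 1, ENNReal.ofReal (weight t u) * g (u * x)
        = ∫⁻ u in Ioo (0 : ℝ) 1,
          ((fun u => ENNReal.ofReal (weight t u * u ^ (-(1 / 2) : ℝ)) ^ (1 / 2 : ℝ)) *
          (fun u => ENNReal.ofReal (weight t u * u ^ (1 / 2 : ℝ)) ^ (1 / 2 : ℝ) * g (u * x))) u := by
      refine setLIntegral_congr_fun measurableSet_Ioo (fun u hu => ?_)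
      simp only [Pi.mul_apply]
      rw [← mul_assoc, ← ENNReal.mul_rpow_of_nonneg _ _ (by norm_num : (0 : ℝ) ≤ 1 / 2),
        ← ENNReal.ofReal_mul (mul_nonneg (weight_nonneg hu) (Real.rpow_nonneg hu.1.le _))]
      congr 1
      have h1 : weight t u * u ^ (-(1 / 2) : ℝ) * (weight t u * u ^ (1 / 2 : ℝ))
          = weight t u ^ 2 := by
        rw [Real.rpow_neg hu.1.le]
        have := (Real.rpow_pos_of_pos hu.1 (1 / 2 : ℝ)).ne'
        field_simp
      rw [h1, ENNReal.ofReal_rpow_of_nonneg (sq_nonneg _) (by norm_num), ← Real.sqrt_eq_rpow,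
        Real.sqrt_sq (weight_nonneg hu)]
    rw [hl]
    refine (ENNReal.rpow_le_rpow hcs (by norm_num : (0 : ℝ) ≤ 2)).trans ?_
    rw [ENNReal.mul_rpow_of_nonneg _ _ (by norm_num), ← ENNReal.rpow_mul, ← ENNReal.rpow_mul]
    simp only [ENNReal.mul_rpow_of_nonneg _ _ (by norm_num : (0 : ℝ) ≤ 2), ← ENNReal.rpow_mul]
    norm_num
    rfl
  calc _ ≤ ∫⁻ x, mass t * ∫⁻ u in Ioo (0 : ℝ) 1,
        ENNReal.ofReal (weight t u * u ^ (1 / 2 : ℝ)) * g (u * x) ^ (2 : ℝ) :=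
        lintegral_mono hpt
    _ = mass t * ∫⁻ u in Ioo (0 : ℝ) 1, ∫⁻ x,
        ENNReal.ofReal (weight t u * u ^ (1 / 2 : ℝ)) * g (u * x) ^ (2 : ℝ) := by
        rw [lintegral_const_mul _ (Measurable.lintegral_prod_right (by fun_prop)),
          lintegral_lintegral_swap (by fun_prop)]
    _ = mass t * ∫⁻ u in Ioo (0 : ℝ) 1,
        ENNReal.ofReal (weight t u * u ^ (-(1 / 2) : ℝ)) * ∫⁻ x, g x ^ (2 : ℝ) := by
        congr 1
        refine setLIntegral_congr_fun measurableSet_Ioo (fun u hu => ?_)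
        have hmap : ∫⁻ x, g (u * x) ^ (2 : ℝ) = ENNReal.ofReal u⁻¹ * ∫⁻ x, g x ^ (2 : ℝ) := by
          rw [← lintegral_map (f := fun y => g y ^ (2 : ℝ)) (by fun_prop) (measurable_const_mul u),
            Real.map_volume_mul_left hu.1.ne', lintegral_smul_measure,
            abs_of_pos (inv_pos.2 hu.1), smul_eq_mul]
        rw [lintegral_const_mul _ (by fun_prop), hmap, ← mul_assoc, ← ENNReal.ofReal_mul
          (mul_nonneg (weight_nonneg hu) (Real.rpow_nonneg hu.1.le _)), mul_assoc,
          ← Real.rpow_neg_one, ← Real.rpow_add hu.1]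
        norm_num
    _ = _ := by
        rw [lintegral_mul_const _ (by fun_prop), ← mul_assoc]
        congr 1
        rw [ENNReal.rpow_two, sq]
        rfl

theorem lintegral_sq_lt_top {f : ℝ → ℂ} (hf : MemLp f 2 volume) :
    ∫⁻ x, ‖f x‖ₑ ^ (2 : ℝ) < ∞ := by
  simpa using lintegral_rpow_enorm_lt_top_of_eLpNorm_lt_top (by simp) (by simp) hf.2

theorem eLpNorm_two (f : ℝ → ℂ) :
    eLpNorm f 2 volume = (∫⁻ x, ‖f x‖ₑ ^ (2 : ℝ)) ^ (1 / 2 : ℝ) := by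
  rw [eLpNorm_eq_lintegral_rpow_enorm_toReal (by simp) (by simp)]
  simp

/-- The integral defining the Hölder mean converges absolutely for almost every `x`. -/
theorem ae_integrableOn {t : ℝ} (ht : 0 < t) {f : ℝ → ℂ} (hm : StronglyMeasurable f)
    (hf : MemLp f 2 volume) :
    ∀ᵐ x, IntegrableOn (fun u => weight t u • f (u * x)) (Ioo 0 1) := by
  have hw := measurable_weight t
  have hg : Measurable (fun x => ‖f x‖ₑ) := hm.enorm
  have hfin : ∫⁻ x, (∫⁻ u in Ioo (0 : ℝ) 1,
      ENNReal.ofReal (weight t u) * ‖f (u * x)‖ₑ) ^ (2 : ℝ) ≠ ∞ :=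
    ((lintegral_sq_le t hg).trans_lt (ENNReal.mul_lt_top
      (ENNReal.rpow_lt_top_of_nonneg (by norm_num) (mass_lt_top ht).ne)
      (lintegral_sq_lt_top hf))).ne
  filter_upwards [ae_lt_top (by
    exact (Measurable.lintegral_prod_right (by fun_prop)).pow_const _) hfin] with x hx
  refine ⟨(hw.stronglyMeasurable.smul
    (hm.comp_measurable (measurable_mul_const x))).aestronglyMeasurable, ?_⟩
  have hx' := (ENNReal.rpow_lt_top_iff_of_pos (by norm_num : (0 : ℝ) < 2)).1 hx
  refine lt_of_eq_of_lt (setLIntegral_congr_fun measurableSet_Ioo (fun u hu => ?_)) hx'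
  simp only
  rw [enorm_smul, Real.enorm_of_nonneg (weight_nonneg hu)]

theorem stronglyMeasurable_holderMean (t : ℝ) {f : ℝ → ℂ} (hm : StronglyMeasurable f) :
    StronglyMeasurable (holderMean t f) := by
  have hw := measurable_weight t
  unfold holderMean
  have : StronglyMeasurable (fun p : ℝ × ℝ => weight t p.2 • f (p.2 * p.1)) :=
    (hw.comp measurable_snd).stronglyMeasurable.smul
      (hm.comp_measurable (measurable_snd.mul measurable_fst))
  have h2 := this.integral_prod_right' (ν := volume.restrict (Ioo (0 : ℝ) 1))
  exact h2.const_smul (1 / Real.Gamma t)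

theorem eLpNorm_holderMean_le (t : ℝ) {f : ℝ → ℂ} (hm : StronglyMeasurable f) :
    eLpNorm (holderMean t f) 2 volume
      ≤ ‖1 / Real.Gamma t‖ₑ * mass t * eLpNorm f 2 volume := by
  have hg : Measurable (fun x => ‖f x‖ₑ) := hm.enorm
  have hb : ∀ x, ‖holderMean t f x‖ₑ ^ (2 : ℝ) ≤ ‖1 / Real.Gamma t‖ₑ ^ (2 : ℝ) *
      (∫⁻ u in Ioo (0 : ℝ) 1, ENNReal.ofReal (weight t u) * ‖f (u * x)‖ₑ) ^ (2 : ℝ) := by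
    intro x
    rw [← ENNReal.mul_rpow_of_nonneg _ _ (by norm_num : (0 : ℝ) ≤ 2)]
    refine ENNReal.rpow_le_rpow ?_ (by norm_num)
    rw [holderMean, enorm_smul]
    refine mul_le_mul_right ((enorm_integral_le_lintegral_enorm _).trans_eq ?_) _
    refine setLIntegral_congr_fun measurableSet_Ioo (fun u hu => ?_)
    rw [enorm_smul, Real.enorm_of_nonneg (weight_nonneg hu)]
  rw [eLpNorm_two, eLpNorm_two]
  have h2 : ∫⁻ x, ‖holderMean t f x‖ₑ ^ (2 : ℝ) ≤
      (‖1 / Real.Gamma t‖ₑ * mass t) ^ (2 : ℝ) * ∫⁻ x, ‖f x‖ₑ ^ (2 : ℝ) := by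
    refine (lintegral_mono hb).trans ?_
    rw [lintegral_const_mul' _ _ (by simp), ENNReal.mul_rpow_of_nonneg _ _ (by norm_num),
      mul_assoc]
    exact mul_le_mul_right (lintegral_sq_le t hg) _
  refine (ENNReal.rpow_le_rpow h2 (by norm_num : (0 : ℝ) ≤ 1 / 2)).trans_eq ?_
  rw [ENNReal.mul_rpow_of_nonneg _ _ (by norm_num), ← ENNReal.rpow_mul]
  norm_num

theorem memLp_holderMean {t : ℝ} (ht : 0 < t) (f : L2R) :
    MemLp (holderMean t f) 2 volume := by
  have hm := Lp.stronglyMeasurable f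
  refine ⟨(stronglyMeasurable_holderMean t hm).aestronglyMeasurable, ?_⟩
  exact (eLpNorm_holderMean_le t hm).trans_lt (ENNReal.mul_lt_top
    (ENNReal.mul_lt_top (by simp) (mass_lt_top ht)) (Lp.memLp f).2)

/-- The Hölder mean does not depend on the representative, up to a null set. -/
theorem holderMean_congr (t : ℝ) {f g : ℝ → ℂ} (h : f =ᵐ[volume] g) {x : ℝ} (hx : x ≠ 0) :
    holderMean t f x = holderMean t g x := by
  have hq : Measure.QuasiMeasurePreserving (fun u : ℝ => u * x) volume volume := by
    refine ⟨measurable_mul_const x, ?_⟩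
    rw [Real.map_volume_mul_right hx]
    exact Measure.smul_absolutelyContinuous
  have h' : ∀ᵐ u : ℝ, f (u * x) = g (u * x) := hq.ae_eq_comp h
  unfold holderMean
  congr 1
  refine integral_congr_ae (ae_restrict_of_ae ?_)
  filter_upwards [h'] with u hu
  rw [hu]

theorem holderMean_add {t : ℝ} (ht : 0 < t) (f g : L2R) :
    holderMean t (f + g : L2R) =ᵐ[volume] holderMean t f + holderMean t g := by
  filter_upwards [ae_integrableOn ht (Lp.stronglyMeasurable f) (Lp.memLp f),
    ae_integrableOn ht (Lp.stronglyMeasurable g) (Lp.memLp g),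
    Measure.ae_ne volume (0 : ℝ)] with x hf hg hx
  rw [holderMean_congr t (Lp.coeFn_add f g) hx]
  simp only [holderMean, Pi.add_apply, smul_add]
  rw [integral_add hf hg, smul_add]

theorem holderMean_smul (t : ℝ) (c : ℂ) (f : L2R) :
    holderMean t (c • f : L2R) =ᵐ[volume] c • holderMean t f := by
  filter_upwards [Measure.ae_ne volume (0 : ℝ)] with x hx
  rw [holderMean_congr t (Lp.coeFn_smul c f) hx]
  simp only [holderMean, Pi.smul_apply]
  rw [smul_comm c, ← integral_smul c]
  congr 2
  funext u
  exact smul_comm _ _ _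

/-- The Hölder mean of order `t > 0` as a linear map on `L²(ℝ)`. -/
def holderLin (t : ℝ) (ht : 0 < t) : L2R →ₗ[ℂ] L2R where
  toFun f := (memLp_holderMean ht f).toLp (holderMean t f)
  map_add' f g := by
    rw [← MemLp.toLp_add (memLp_holderMean ht f) (memLp_holderMean ht g)]
    exact MemLp.toLp_congr _ _ (holderMean_add ht f g)
  map_smul' c f := by
    rw [RingHom.id_apply, ← MemLp.toLp_const_smul c (memLp_holderMean ht f)]
    exact MemLp.toLp_congr _ _ (holderMean_smul t c f)

theorem norm_holderLin_le (t : ℝ) (ht : 0 < t) (f : L2R) :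
    ‖holderLin t ht f‖ ≤ (‖1 / Real.Gamma t‖ₑ * mass t).toReal * ‖f‖ := by
  have h1 : ‖holderLin t ht f‖ = (eLpNorm (holderMean t f) 2 volume).toReal :=
    Lp.norm_toLp _ (memLp_holderMean ht f)
  rw [h1, Lp.norm_def, ← ENNReal.toReal_mul]
  exact ENNReal.toReal_mono (ENNReal.mul_lt_top
    (ENNReal.mul_lt_top (by simp) (mass_lt_top ht)) (Lp.memLp f).2).ne
    (eLpNorm_holderMean_le t (Lp.stronglyMeasurable f))

/-- The Hölder mean of order `t > 0` as a bounded operator on `L²(ℝ)`. -/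
def holderPos (t : ℝ) (ht : 0 < t) : L2R →L[ℂ] L2R :=
  (holderLin t ht).mkContinuous _ (norm_holderLin_le t ht)

/-- The family `H_t`, with `H_0 = I`. Only the values at `t ≥ 0` are meaningful. -/
def H (t : ℝ) : L2R →L[ℂ] L2R :=
  if ht : 0 < t then holderPos t ht else ContinuousLinearMap.id ℂ L2R

theorem coeFn_H {t : ℝ} (ht : 0 < t) (f : L2R) : H t f =ᵐ[volume] holderMean t f := by
  rw [H, dif_pos ht]
  exact MemLp.coeFn_toLp (memLp_holderMean ht f)

/-- The rescaled family `T(t) = 2^{-t} H_t`. -/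
def T (t : ℝ) : L2R →L[ℂ] L2R := ((2 : ℝ) ^ (-t)) • H t

/-- Strongly continuous one-parameter semigroups (indexed by `t ≥ 0`) of bounded operators
on a Banach space. -/
structure IsC0Semigroup {E : Type*} [NormedAddCommGroup E] [NormedSpace ℂ E]
    (S : ℝ → E →L[ℂ] E) : Prop where
  zero : S 0 = ContinuousLinearMap.id ℂ E
  add : ∀ s t : ℝ, 0 ≤ s → 0 ≤ t → S (s + t) = (S s).comp (S t)
  continuousOn : ∀ f : E, ContinuousOn (fun t => S t f) (Ici 0)

end HolderMeans

end

/-! Substituting u = e^{-v} turns `T t f` into the mean of D_v f, where D_v f(x) = e^{-v/2} f(e^{-v}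
x), over the gamma distribution γ_t of shape t and rate 1/2 (`T_apply_eq_integral`). The D_v form a
strongly continuous group of isometries, so each property of T reflects one of γ_t. The semigroup
law is γ_s ∗ γ_t = γ_{s+t}. Contractivity is total mass 1. Continuity at 0 holds because the mean 2t
of γ_t tends to 0.

For stability, γ_{t+1} has density v/(2t) with respect to γ_t, and the L¹ distance of this density
from 1 is at most its standard deviation 1/√t. Hence T(t)(f - T(1)f) → 0 for every f. The range of I
- T(1) is dense: if g is orthogonal to it, then ⟨g, D_v g⟩ averages to ‖g‖², so D_v g = g for some v
> 0. Then g has the same L² mass on a ball as on arbitrarily small balls, so g = 0. Contractivity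
extends the limit from this dense range to all of L². -/

namespace ProbabilityTheory

/-! ### Gamma distributions: the convolution law. -/

theorem measurable_gammaPDF (a r : ℝ) : Measurable (gammaPDF a r) :=
  (measurable_gammaPDFReal a r).ennreal_ofReal

/-- This is the convolution integrand after y = xw: the exponentials multiply to one independent of
w, and the rest is a beta density. The endpoints are excluded because the gamma density at 0 need
not vanish (shape 1), while the beta density does. -/
theorem gammaPDF_mul_gammaPDF {a b r : ℝ} (ha : 0 < a) (hb : 0 < b) (hr : 0 < r) {x : ℝ}
    (hx : 0 < x) {w : ℝ} (hw0 : w ≠ 0) (hw1 : w ≠ 1) :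
    ENNReal.ofReal x * (gammaPDF a r (x * w) * gammaPDF b r (-(x * w) + x))
      = gammaPDF (a + b) r x * betaPDF a b w := by
  rcases lt_or_gt_of_ne hw0 with h0 | h0
  · rw [gammaPDF_of_neg (mul_neg_of_pos_of_neg hx h0), betaPDF_eq_zero_of_nonpos h0.le]
    simp
  rcases lt_or_gt_of_ne hw1 with h1 | h1
  · have e : -(x * w) + x = x * (1 - w) := by ring
    have h1' : 0 < 1 - w := by linarith
    rw [e, gammaPDF_of_nonneg (by positivity), gammaPDF_of_nonneg (by positivity),
      gammaPDF_of_nonneg hx.le, betaPDF_of_pos_lt_one h0 h1,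
      ← ENNReal.ofReal_mul (by positivity), ← ENNReal.ofReal_mul (by positivity),
      ← ENNReal.ofReal_mul (by positivity)]
    congr 1
    have e1 : r ^ (a + b) = r ^ a * r ^ b := Real.rpow_add hr _ _
    have e2 : x ^ (a + b - 1) = x * x ^ (a - 1) * x ^ (b - 1) := by
      nth_rewrite 2 [← Real.rpow_one x]
      rw [← Real.rpow_add hx, ← Real.rpow_add hx]
      ring_nf
    have e3 : Real.exp (-(r * x)) = Real.exp (-(r * (x * w))) * Real.exp (-(r * (x * (1 - w)))) := by
      rw [← Real.exp_add]
      ring_nf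
    rw [Real.mul_rpow hx.le h0.le, Real.mul_rpow hx.le h1'.le, e1, e2, e3, beta]
    have := (Real.Gamma_pos_of_pos ha).ne'
    have := (Real.Gamma_pos_of_pos hb).ne'
    have := (Real.Gamma_pos_of_pos (add_pos ha hb)).ne'
    field_simp
  · rw [gammaPDF_of_neg (x := -(x * w) + x) (by nlinarith), betaPDF_eq_zero_of_one_le h1.le]
    simp

/-- The beta density has integral 1. At x = 0 equality can fail: for a + b = 1 the left side is 0
and the right side is r, since 0 ^ 0 = 1. -/
theorem lintegral_gammaPDF_mul_gammaPDF {a b r : ℝ} (ha : 0 < a) (hb : 0 < b) (hr : 0 < r)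
    {x : ℝ} (hx : x ≠ 0) :
    ∫⁻ y, gammaPDF a r y * gammaPDF b r (-y + x) = gammaPDF (a + b) r x := by
  have hm := measurable_gammaPDF
  rcases lt_or_gt_of_ne hx with h | h
  · rw [gammaPDF_of_neg h, lintegral_eq_zero_iff (by fun_prop)]
    refine Eventually.of_forall fun y => ?_
    rcases lt_or_ge y 0 with hy | hy
    · simp [gammaPDF_of_neg hy]
    · simp [gammaPDF_of_neg (a := b) (r := r) (x := -y + x) (by linarith)]
  · have hmap : ∫⁻ y, gammaPDF a r y * gammaPDF b r (-y + x)
        = ENNReal.ofReal x * ∫⁻ w, gammaPDF a r (x * w) * gammaPDF b r (-(x * w) + x) := by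
      rw [← lintegral_map (f := fun y => gammaPDF a r y * gammaPDF b r (-y + x))
        (by fun_prop) (measurable_const_mul x), Real.map_volume_mul_left h.ne',
        lintegral_smul_measure, abs_of_pos (inv_pos.2 h), smul_eq_mul, ← mul_assoc,
        ← ENNReal.ofReal_mul h.le, mul_inv_cancel₀ h.ne']
      simp
    rw [hmap, ← lintegral_const_mul _ (by fun_prop)]
    have : ∫⁻ w, ENNReal.ofReal x * (gammaPDF a r (x * w) * gammaPDF b r (-(x * w) + x))
        = ∫⁻ w, gammaPDF (a + b) r x * betaPDF a b w := by
      refine lintegral_congr_ae ?_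
      filter_upwards [Measure.ae_ne volume (0 : ℝ), Measure.ae_ne volume (1 : ℝ)] with w h0 h1
      exact gammaPDF_mul_gammaPDF ha hb hr h h0 h1
    rw [this, lintegral_const_mul (f := betaPDF a b) _ (measurable_betaPDFReal a b).ennreal_ofReal,
      lintegral_betaPDF_eq_one ha hb, mul_one]

/-- Gamma distributions with the same rate form a convolution semigroup. -/
theorem gammaMeasure_conv_gammaMeasure {a b r : ℝ} (ha : 0 < a) (hb : 0 < b) (hr : 0 < r) :
    gammaMeasure a r ∗ gammaMeasure b r = gammaMeasure (a + b) r := by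
  unfold gammaMeasure
  rw [conv_withDensity_eq_lconvolution (measurable_gammaPDF a r) (measurable_gammaPDF b r)]
  refine withDensity_congr_ae ?_
  filter_upwards [Measure.ae_ne volume (0 : ℝ)] with x hx
  exact lintegral_gammaPDF_mul_gammaPDF ha hb hr hx

theorem ae_pos_gammaMeasure (a r : ℝ) : ∀ᵐ v ∂gammaMeasure a r, 0 < v := by
  rw [gammaMeasure, ae_withDensity_iff (measurable_gammaPDF a r)]
  filter_upwards [Measure.ae_ne volume (0 : ℝ)] with v hv h
  rcases lt_or_gt_of_ne hv with h0 | h0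
  · exact absurd (gammaPDF_of_neg h0) h
  · exact h0

/-! ### Gamma distributions: raising the shape by one, and moments. -/

theorem gammaPDF_add_one {a r : ℝ} (ha : 0 < a) (hr : 0 < r) (v : ℝ) :
    gammaPDF (a + 1) r v = gammaPDF a r v * ENNReal.ofReal (r / a * v) := by
  rcases lt_trichotomy v 0 with h | rfl | h
  · simp [gammaPDF_of_neg h]
  · simp [gammaPDF_of_nonneg, Real.zero_rpow ha.ne']
  · rw [gammaPDF_of_nonneg h.le, gammaPDF_of_nonneg h.le, ← ENNReal.ofReal_mul (by positivity)]
    congr 1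
    rw [Real.Gamma_add_one ha.ne', Real.rpow_add hr, Real.rpow_one, add_sub_cancel_right,
      Real.rpow_sub h, Real.rpow_one]
    have := (Real.Gamma_pos_of_pos ha).ne'
    field_simp

theorem gammaMeasure_add_one {a r : ℝ} (ha : 0 < a) (hr : 0 < r) :
    gammaMeasure (a + 1) r
      = (gammaMeasure a r).withDensity fun v => ENNReal.ofReal (r / a * v) := by
  rw [gammaMeasure, gammaMeasure, ← withDensity_mul _ (measurable_gammaPDF a r) (by fun_prop)]
  congr 1
  funext v
  exact gammaPDF_add_one ha hr v

variable {E : Type*} [NormedAddCommGroup E] [NormedSpace ℝ E]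

theorem integral_gammaMeasure_add_one {a r : ℝ} (ha : 0 < a) (hr : 0 < r) (F : ℝ → E) :
    ∫ v, F v ∂gammaMeasure (a + 1) r = ∫ v, (r / a * v) • F v ∂gammaMeasure a r := by
  rw [gammaMeasure_add_one ha hr, integral_withDensity_eq_integral_toReal_smul (by fun_prop)
    (by simp)]
  refine integral_congr_ae ?_
  filter_upwards [ae_pos_gammaMeasure a r] with v hv
  rw [ENNReal.toReal_ofReal (by positivity)]

theorem integrable_gammaMeasure_add_one_iff {a r : ℝ} (ha : 0 < a) (hr : 0 < r) (F : ℝ → E) :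
    Integrable F (gammaMeasure (a + 1) r)
      ↔ Integrable (fun v => (r / a * v) • F v) (gammaMeasure a r) := by
  rw [gammaMeasure_add_one ha hr, integrable_withDensity_iff_integrable_smul' (by fun_prop)
    (by simp)]
  refine integrable_congr ?_
  filter_upwards [ae_pos_gammaMeasure a r] with v hv
  rw [ENNReal.toReal_ofReal (by positivity)]

/-- Moments come from the change of shape: the total mass at shape a + 1 is the normalised first
moment at shape a. -/
theorem integrable_mul_gammaMeasure {a r : ℝ} (ha : 0 < a) (hr : 0 < r) :
    Integrable (fun v => r / a * v) (gammaMeasure a r) := by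
  have := isProbabilityMeasure_gammaMeasure (add_pos ha one_pos) hr
  simpa using (integrable_gammaMeasure_add_one_iff ha hr (fun _ => (1 : ℝ))).1
    (integrable_const _)

theorem integral_mul_gammaMeasure {a r : ℝ} (ha : 0 < a) (hr : 0 < r) :
    ∫ v, r / a * v ∂gammaMeasure a r = 1 := by
  have := isProbabilityMeasure_gammaMeasure (add_pos ha one_pos) hr
  simpa using (integral_gammaMeasure_add_one ha hr (fun _ => (1 : ℝ))).symm

theorem integral_id_gammaMeasure {a r : ℝ} (ha : 0 < a) (hr : 0 < r) :
    ∫ v, v ∂gammaMeasure a r = a / r := by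
  have := integral_mul_gammaMeasure ha hr
  rw [integral_const_mul] at this
  field_simp at this ⊢
  linarith

/-- The first moment at shape a + 1 is a second moment at shape a; the factor (a + 1)/a replaces
r/(a + 1) by r/a. -/
theorem integrable_sq_gammaMeasure {a r : ℝ} (ha : 0 < a) (hr : 0 < r) :
    Integrable (fun v => (r / a * v) ^ 2) (gammaMeasure a r) := by
  have h := (integrable_gammaMeasure_add_one_iff ha hr _).1
    (integrable_mul_gammaMeasure (add_pos ha one_pos) hr)
  refine (h.const_mul ((a + 1) / a)).congr (Eventually.of_forall fun v => ?_)
  simp only [smul_eq_mul]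
  field_simp

theorem integral_sq_gammaMeasure {a r : ℝ} (ha : 0 < a) (hr : 0 < r) :
    ∫ v, (r / a * v) ^ 2 ∂gammaMeasure a r = (a + 1) / a := by
  have h := integral_mul_gammaMeasure (add_pos ha one_pos) hr
  rw [integral_gammaMeasure_add_one ha hr] at h
  have h2 := congrArg (fun c => (a + 1) / a * c) h
  simp only [mul_one, ← integral_const_mul] at h2
  rw [← h2]
  refine integral_congr_ae (Eventually.of_forall fun v => ?_)
  simp only [smul_eq_mul]
  field_simp

/-- Weighted AM-GM, standing in for Cauchy–Schwarz: with second moment 1/a, the choice c = √a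
balances the two terms and gives 1/√a. -/
theorem abs_le_half_add_mul_sq {c : ℝ} (hc : 0 < c) (x : ℝ) :
    |x| ≤ 1 / c / 2 + c / 2 * x ^ 2 := by
  have h : 0 ≤ c / 2 * (1 / c - |x|) ^ 2 := by positivity
  have e : c / 2 * (1 / c - |x|) ^ 2 = 1 / c / 2 - |x| + c / 2 * x ^ 2 := by
    rw [← sq_abs x]
    field_simp
    ring
  linarith

theorem one_sub_mul_sq_eq (a r : ℝ) : (fun v => (1 - r / a * v) ^ 2)
    = fun v => (1 - 2 * (r / a * v)) + (r / a * v) ^ 2 := by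
  funext v
  ring

theorem integrable_one_sub_two_mul_gammaMeasure {a r : ℝ} (ha : 0 < a) (hr : 0 < r) :
    Integrable (fun v => 1 - 2 * (r / a * v)) (gammaMeasure a r) := by
  have := isProbabilityMeasure_gammaMeasure ha hr
  exact (integrable_const (1 : ℝ)).sub ((integrable_mul_gammaMeasure ha hr).const_mul 2)

theorem integrable_one_sub_sq_gammaMeasure {a r : ℝ} (ha : 0 < a) (hr : 0 < r) :
    Integrable (fun v => (1 - r / a * v) ^ 2) (gammaMeasure a r) := by
  rw [one_sub_mul_sq_eq]
  exact (integrable_one_sub_two_mul_gammaMeasure ha hr).add (integrable_sq_gammaMeasure ha hr)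

theorem integral_one_sub_sq_gammaMeasure {a r : ℝ} (ha : 0 < a) (hr : 0 < r) :
    ∫ v, (1 - r / a * v) ^ 2 ∂gammaMeasure a r = 1 / a := by
  have := isProbabilityMeasure_gammaMeasure ha hr
  rw [one_sub_mul_sq_eq, integral_add (integrable_one_sub_two_mul_gammaMeasure ha hr)
    (integrable_sq_gammaMeasure ha hr), integral_sub (integrable_const (1 : ℝ))
    ((integrable_mul_gammaMeasure ha hr).const_mul 2), integral_const_mul,
    integral_mul_gammaMeasure ha hr, integral_sq_gammaMeasure ha hr, integral_const,
    probReal_univ, smul_eq_mul]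
  field_simp
  ring

/-- The total variation distance of consecutive gamma distributions. -/
theorem integral_abs_one_sub_gammaMeasure_le {a r : ℝ} (ha : 0 < a) (hr : 0 < r) :
    ∫ v, |1 - r / a * v| ∂gammaMeasure a r ≤ 1 / √a := by
  have := isProbabilityMeasure_gammaMeasure ha hr
  have hs : 0 < √a := Real.sqrt_pos.2 ha
  have j := (integrable_one_sub_sq_gammaMeasure ha hr).const_mul (√a / 2)
  have j' : Integrable (fun v => 1 / √a / 2 + √a / 2 * (1 - r / a * v) ^ 2) (gammaMeasure a r) :=
    (integrable_const (1 / √a / 2)).add j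
  calc ∫ v, |1 - r / a * v| ∂gammaMeasure a r
      ≤ ∫ v, 1 / √a / 2 + √a / 2 * (1 - r / a * v) ^ 2 ∂gammaMeasure a r :=
        integral_mono_of_nonneg (Eventually.of_forall fun v => abs_nonneg _) j'
          (Eventually.of_forall fun v => abs_le_half_add_mul_sq hs _)
    _ = 1 / √a := by
      rw [integral_add (integrable_const _) j, integral_const_mul,
        integral_one_sub_sq_gammaMeasure ha hr, integral_const, probReal_univ, smul_eq_mul]
      have h2 : √a / 2 * (1 / a) = 1 / √a / 2 := by
        rw [div_mul_div_comm, mul_one, mul_comm 2 a, ← div_div, Real.sqrt_div_self']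
      rw [h2, one_mul, add_halves]

end ProbabilityTheory

/-! ### The group of dilations on L²(ℝ). -/

namespace HolderMeans

open ProbabilityTheory

/-- The unitary dilation `x ↦ e^{-v/2} f(e^{-v} x)`. -/
noncomputable def dilate (v : ℝ) (f : ℝ → ℂ) (x : ℝ) : ℂ :=
  Real.exp (-v / 2) • f (Real.exp (-v) * x)

theorem lintegral_comp_mul_left {φ : ℝ → ℝ≥0∞} (hφ : Measurable φ) {c : ℝ} (hc : 0 < c) :
    ∫⁻ x, φ (c * x) = ENNReal.ofReal c⁻¹ * ∫⁻ x, φ x := by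
  rw [← lintegral_map hφ (measurable_const_mul c), Real.map_volume_mul_left hc.ne',
    lintegral_smul_measure, abs_of_pos (inv_pos.2 hc), smul_eq_mul]

theorem enorm_dilate_sq (v : ℝ) (f : ℝ → ℂ) (x : ℝ) :
    ‖dilate v f x‖ₑ ^ (2 : ℝ)
      = ENNReal.ofReal (Real.exp (-v)) * ‖f (Real.exp (-v) * x)‖ₑ ^ (2 : ℝ) := by
  rw [dilate, enorm_smul, ENNReal.mul_rpow_of_nonneg _ _ (by norm_num),
    Real.enorm_of_nonneg (Real.exp_pos _).le, ENNReal.ofReal_rpow_of_pos (Real.exp_pos _),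
    ← Real.exp_mul]
  ring_nf

theorem setLIntegral_ball_dilate (v R : ℝ) {f : ℝ → ℂ} (hf : StronglyMeasurable f) :
    ∫⁻ x in Metric.ball 0 R, ‖dilate v f x‖ₑ ^ (2 : ℝ)
      = ∫⁻ x in Metric.ball 0 (Real.exp (-v) * R), ‖f x‖ₑ ^ (2 : ℝ) := by
  have hm : Measurable fun x => ‖f x‖ₑ ^ (2 : ℝ) := hf.enorm.pow_const _
  have he := Real.exp_pos (-v)
  rw [← lintegral_indicator measurableSet_ball, ← lintegral_indicator measurableSet_ball]
  have h := lintegral_comp_mul_left (hm.indicator (s := Metric.ball 0 (Real.exp (-v) * R))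
    measurableSet_ball) he
  have h2 := congrArg (fun c => ENNReal.ofReal (Real.exp (-v)) * c) h
  simp only [← mul_assoc, ← ENNReal.ofReal_mul he.le, mul_inv_cancel₀ he.ne', ENNReal.ofReal_one,
    one_mul] at h2
  rw [← h2, ← lintegral_const_mul' _ _ (by simp)]
  refine lintegral_congr fun x => ?_
  have hb : Real.exp (-v) * x ∈ Metric.ball (0 : ℝ) (Real.exp (-v) * R)
      ↔ x ∈ Metric.ball (0 : ℝ) R := by
    simp [mul_lt_mul_iff_right₀ he]
  by_cases hx : x ∈ Metric.ball (0 : ℝ) R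
  · rw [indicator_of_mem hx, indicator_of_mem (hb.2 hx), enorm_dilate_sq]
  · rw [indicator_of_notMem hx, indicator_of_notMem (mt hb.1 hx), mul_zero]

theorem lintegral_dilate (v : ℝ) {f : ℝ → ℂ} (hf : StronglyMeasurable f) :
    ∫⁻ x, ‖dilate v f x‖ₑ ^ (2 : ℝ) = ∫⁻ x, ‖f x‖ₑ ^ (2 : ℝ) := by
  have hm : Measurable fun x => ‖f x‖ₑ ^ (2 : ℝ) := hf.enorm.pow_const _
  have he := Real.exp_pos (-v)
  simp only [enorm_dilate_sq]
  rw [lintegral_const_mul' _ _ (by simp), lintegral_comp_mul_left hm he, ← mul_assoc,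
    ← ENNReal.ofReal_mul he.le, mul_inv_cancel₀ he.ne', ENNReal.ofReal_one, one_mul]

theorem eLpNorm_dilate (v : ℝ) {f : ℝ → ℂ} (hf : StronglyMeasurable f) :
    eLpNorm (dilate v f) 2 volume = eLpNorm f 2 volume := by
  rw [eLpNorm_two, eLpNorm_two, lintegral_dilate v hf]

theorem stronglyMeasurable_dilate (v : ℝ) {f : ℝ → ℂ} (hf : StronglyMeasurable f) :
    StronglyMeasurable (dilate v f) :=
  (hf.comp_measurable (measurable_const_mul _)).const_smul (Real.exp (-v / 2))

theorem dilate_congr (v : ℝ) {f g : ℝ → ℂ} (h : f =ᵐ[volume] g) :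
    dilate v f =ᵐ[volume] dilate v g := by
  have hq : Measure.QuasiMeasurePreserving (fun x : ℝ => Real.exp (-v) * x) volume volume := by
    refine ⟨measurable_const_mul _, ?_⟩
    rw [Real.map_volume_mul_left (Real.exp_pos _).ne']
    exact Measure.smul_absolutelyContinuous
  filter_upwards [hq.ae_eq_comp h] with x hx
  simp only [Function.comp_apply] at hx
  rw [dilate, dilate, hx]

theorem dilate_dilate (v w : ℝ) (f : ℝ → ℂ) : dilate v (dilate w f) = dilate (v + w) f := by
  funext x
  simp only [dilate, smul_smul, ← Real.exp_add, ← mul_assoc]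
  ring_nf

theorem memLp_dilate (v : ℝ) (f : L2R) : MemLp (dilate v f) 2 volume :=
  ⟨(stronglyMeasurable_dilate v (Lp.stronglyMeasurable f)).aestronglyMeasurable,
    (eLpNorm_dilate v (Lp.stronglyMeasurable f)).trans_lt (Lp.memLp f).2⟩

/-- The group of unitary dilations of `L²(ℝ)`. -/
noncomputable def dilation (v : ℝ) : L2R →ₗᵢ[ℂ] L2R where
  toFun f := (memLp_dilate v f).toLp (dilate v f)
  map_add' f g := by
    rw [← MemLp.toLp_add (memLp_dilate v f) (memLp_dilate v g)]
    refine MemLp.toLp_congr _ _ ((dilate_congr v (Lp.coeFn_add f g)).trans ?_)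
    exact Eventually.of_forall fun x => smul_add _ _ _
  map_smul' c f := by
    rw [RingHom.id_apply, ← MemLp.toLp_const_smul c (memLp_dilate v f)]
    refine MemLp.toLp_congr _ _ ((dilate_congr v (Lp.coeFn_smul c f)).trans ?_)
    exact Eventually.of_forall fun x => smul_comm (Real.exp (-v / 2)) c _
  norm_map' f := by
    change ‖(memLp_dilate v f).toLp (dilate v f)‖ = ‖f‖
    rw [Lp.norm_toLp, eLpNorm_dilate v (Lp.stronglyMeasurable f), Lp.norm_def]

theorem coeFn_dilation (v : ℝ) (f : L2R) : dilation v f =ᵐ[volume] dilate v f :=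
  MemLp.coeFn_toLp (memLp_dilate v f)

theorem dilation_dilation (v w : ℝ) (f : L2R) :
    dilation v (dilation w f) = dilation (v + w) f := by
  refine Lp.ext ((coeFn_dilation v _).trans ?_)
  refine (dilate_congr v (coeFn_dilation w f)).trans ?_
  rw [dilate_dilate]
  exact (coeFn_dilation _ f).symm

theorem dilation_zero (f : L2R) : dilation 0 f = f := by
  refine Lp.ext ((coeFn_dilation 0 f).trans (Eventually.of_forall fun x => ?_))
  simp [dilate]

/-- Dominated convergence: for |v| < 1 all dilates are supported in one ball, of radius e·R, and are
bounded by e^{1/2}·M. -/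
theorem tendsto_dilation_zero_of_continuous {g : ℝ → ℂ} (hg : Continuous g)
    (hc : HasCompactSupport g) :
    Tendsto (fun v => ∫⁻ x, ‖dilate v g x - g x‖ₑ ^ (2 : ℝ)) (𝓝 0) (𝓝 0) := by
  obtain ⟨M, hM⟩ := hc.exists_bound_of_continuous hg
  obtain ⟨R, hR, hsub⟩ := hc.isCompact.isBounded.subset_ball_lt 0 (0 : ℝ)
  have hM0 : 0 ≤ M := (norm_nonneg _).trans (hM 0)
  have hcont : ∀ x, Continuous fun v => dilate v g x := by
    intro x
    unfold dilate
    fun_prop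
  let bound : ℝ → ℝ≥0∞ := (Metric.ball (0 : ℝ) (Real.exp 1 * R)).indicator
    fun _ => ENNReal.ofReal (Real.exp (1 / 2) * M + M) ^ (2 : ℝ)
  have key : ∀ᶠ v : ℝ in 𝓝 0, ∀ x, ‖dilate v g x - g x‖ₑ ^ (2 : ℝ) ≤ bound x := by
    filter_upwards [Metric.ball_mem_nhds (0 : ℝ) one_pos] with v hv x
    rw [Metric.mem_ball, dist_zero_right, Real.norm_eq_abs, abs_lt] at hv
    by_cases hx : x ∈ Metric.ball (0 : ℝ) (Real.exp 1 * R)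
    · simp only [bound, indicator_of_mem hx]
      refine ENNReal.rpow_le_rpow ?_ (by norm_num)
      rw [← ofReal_norm]
      refine ENNReal.ofReal_le_ofReal ((norm_sub_le _ _).trans (add_le_add ?_ (hM x)))
      rw [dilate, norm_smul, Real.norm_eq_abs, abs_of_pos (Real.exp_pos _)]
      have := hM (Real.exp (-v) * x)
      have : Real.exp (-v / 2) ≤ Real.exp (1 / 2) := Real.exp_le_exp.2 (by linarith)
      gcongr
    · have hx' : Real.exp 1 * R ≤ |x| := by simpa using hx
      have h1 : g x = 0 := by
        by_contra h
        have := hsub (subset_tsupport g h)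
        rw [Metric.mem_ball, dist_zero_right, Real.norm_eq_abs] at this
        nlinarith [Real.add_one_le_exp (1 : ℝ)]
      have h2 : g (Real.exp (-v) * x) = 0 := by
        by_contra h
        have := hsub (subset_tsupport g h)
        rw [Metric.mem_ball, dist_zero_right, Real.norm_eq_abs, abs_mul,
          abs_of_pos (Real.exp_pos _)] at this
        have h3 : Real.exp (-v) * (Real.exp 1 * R) ≤ Real.exp (-v) * |x| := by gcongr
        rw [← mul_assoc, ← Real.exp_add] at h3
        have h4 : 1 ≤ Real.exp (-v + 1) := Real.one_le_exp (by linarith)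
        nlinarith
      simp [dilate, h1, h2]
  have h := tendsto_lintegral_filter_of_dominated_convergence (μ := volume) (l := 𝓝 (0 : ℝ))
    (F := fun v x => ‖dilate v g x - g x‖ₑ ^ (2 : ℝ)) (f := fun _ => 0) bound
    (Eventually.of_forall fun v =>
      ((stronglyMeasurable_dilate v hg.stronglyMeasurable).sub
        hg.stronglyMeasurable).enorm.pow_const _)
    (key.mono fun v hv => Eventually.of_forall hv)
    (by
      rw [lintegral_indicator measurableSet_ball, setLIntegral_const]
      exact ENNReal.mul_ne_top (by simp) measure_ball_lt_top.ne)
    (Eventually.of_forall fun x => by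
      have hc : Continuous fun v => ‖dilate v g x - g x‖ₑ ^ (2 : ℝ) :=
        ENNReal.continuous_rpow_const.comp ((hcont x).sub continuous_const).enorm
      have := hc.tendsto 0
      simpa [dilate] using this)
  simpa using h

theorem tendsto_dilation_zero (f : L2R) : Tendsto (fun v => dilation v f) (𝓝 0) (𝓝 f) := by
  rw [Metric.tendsto_nhds]
  intro ε hε
  -- The error f - G is paid twice, once dilated isometrically; with the movement of G this totals
  -- less than 3ε/4.
  obtain ⟨g, hgc, hfg, hg, hgm⟩ := (Lp.memLp f).exists_hasCompactSupport_eLpNorm_sub_le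
    (by simp) (ε := ENNReal.ofReal (ε / 4)) (by simpa using hε)
  set G : L2R := hgm.toLp g
  have hGg : G =ᵐ[volume] g := MemLp.coeFn_toLp hgm
  have h1 : ‖f - G‖ ≤ ε / 4 := by
    rw [Lp.norm_def, eLpNorm_congr_ae ((Lp.coeFn_sub f G).trans ((ae_eq_refl f).sub hGg))]
    exact ENNReal.toReal_le_of_le_ofReal (by positivity) hfg
  have h2 : ∀ v, ‖dilation v G - G‖
      = ((∫⁻ x, ‖dilate v g x - g x‖ₑ ^ (2 : ℝ)) ^ (1 / 2 : ℝ)).toReal := by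
    intro v
    rw [Lp.norm_def, eLpNorm_congr_ae ((Lp.coeFn_sub _ G).trans
      (((coeFn_dilation v G).trans (dilate_congr v hGg)).sub hGg)), eLpNorm_two]
    rfl
  have h3 : Tendsto (fun v => ‖dilation v G - G‖) (𝓝 0) (𝓝 0) := by
    simp only [h2]
    have := ((ENNReal.continuous_rpow_const (y := 1 / 2)).tendsto _).comp
      (tendsto_dilation_zero_of_continuous hg hgc)
    rw [ENNReal.zero_rpow_of_pos (by norm_num)] at this
    exact (ENNReal.tendsto_toReal ENNReal.zero_ne_top).comp this
  filter_upwards [h3.eventually_lt_const (show (0 : ℝ) < ε / 4 by positivity)] with v hv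
  rw [dist_eq_norm]
  have e : dilation v f - f = dilation v (f - G) + (dilation v G - G) - (f - G) := by
    rw [map_sub]
    abel
  rw [e]
  have := norm_sub_le (dilation v (f - G) + (dilation v G - G)) (f - G)
  have := norm_add_le (dilation v (f - G)) (dilation v G - G)
  rw [(dilation v).norm_map] at this
  linarith

theorem continuous_dilation (f : L2R) : Continuous fun v => dilation v f := by
  rw [continuous_iff_continuousAt]
  intro w
  have h : Tendsto (fun v => dilation (v - w) (dilation w f)) (𝓝 w) (𝓝 (dilation w f)) :=
    (tendsto_dilation_zero (dilation w f)).comp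
      (tendsto_sub_nhds_zero_iff.2 tendsto_id)
  simpa [ContinuousAt, dilation_dilation] using h

/-- A nontrivial dilation has no fixed vectors. -/
theorem eq_zero_of_dilation_eq_self {v : ℝ} (hv : 0 < v) {g : L2R} (h : dilation v g = g) :
    g = 0 := by
  have hm := Lp.stronglyMeasurable g
  have hn : ∀ n : ℕ, dilation (n * v) g = g := by
    intro n
    induction n with
    | zero => simpa using dilation_zero g
    | succ n ih =>
      have e : ((n + 1 : ℕ) : ℝ) * v = v + n * v := by push_cast; ring
      rw [e, ← dilation_dilation, ih, h]
  -- Invariance equates the mass on a ball with that on balls shrinking to measure zero.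
  have hball : ∀ R : ℝ, ∫⁻ x in Metric.ball 0 R, ‖g x‖ₑ ^ (2 : ℝ) = 0 := by
    intro R
    have hconst : ∀ n : ℕ, ∫⁻ x in Metric.ball 0 R, ‖g x‖ₑ ^ (2 : ℝ)
        = ∫⁻ x in Metric.ball 0 (Real.exp (-(n * v)) * R), ‖g x‖ₑ ^ (2 : ℝ) := by
      intro n
      rw [← setLIntegral_ball_dilate _ _ hm]
      refine lintegral_congr_ae (ae_restrict_of_ae ?_)
      have := coeFn_dilation (n * v) g
      rw [hn n] at this
      filter_upwards [this] with x hx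
      rw [← hx]
    have hlim : Tendsto (fun n : ℕ => ∫⁻ x in Metric.ball 0 (Real.exp (-(n * v)) * R),
        ‖g x‖ₑ ^ (2 : ℝ)) atTop (𝓝 0) := by
      refine tendsto_setLIntegral_zero (lintegral_sq_lt_top (Lp.memLp g)).ne ?_
      have h1 : Tendsto (fun n : ℕ => 2 * (Real.exp (-(n * v)) * R)) atTop (𝓝 0) := by
        have : Tendsto (fun n : ℕ => Real.exp (-(n * v))) atTop (𝓝 0) :=
          Real.tendsto_exp_neg_atTop_nhds_zero.comp
            (tendsto_natCast_atTop_atTop.atTop_mul_const hv)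
        simpa using (this.mul_const R).const_mul 2
      have := ENNReal.tendsto_ofReal h1
      simpa [Function.comp_def, Real.volume_ball] using this
    exact tendsto_nhds_unique (tendsto_const_nhds.congr hconst) hlim
  have hae : ∀ᵐ x, g x = 0 := by
    have hn : ∀ n : ℕ, ∀ᵐ x ∂volume.restrict (Metric.ball (0 : ℝ) n), g x = 0 := by
      intro n
      have := (lintegral_eq_zero_iff (hm.enorm.pow_const (2 : ℝ))).1 (hball n)
      filter_upwards [this] with x hx
      simpa using hx
    have := (ae_restrict_iUnion_iff (fun n : ℕ => Metric.ball (0 : ℝ) n) _).2 hn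
    rwa [Metric.iUnion_ball_nat, Measure.restrict_univ] at this
  exact (Lp.eq_zero_iff_ae_eq_zero).2 hae

/-! ### The operators T(t) as gamma averages of dilations. -/

theorem image_exp_neg_Ioi : (fun v : ℝ => Real.exp (-v)) '' Ioi 0 = Ioo 0 1 := by
  ext u
  constructor
  · rintro ⟨v, hv, rfl⟩
    exact ⟨Real.exp_pos _, by simpa using hv⟩
  · intro hu
    refine ⟨-Real.log u, ?_, ?_⟩
    · simpa using Real.log_neg hu.1 hu.2
    · simp [Real.exp_log hu.1]

theorem setIntegral_Ioo_eq_setIntegral_exp_neg (F : ℝ → ℂ) :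
    ∫ u in Ioo (0 : ℝ) 1, F u = ∫ v in Ioi (0 : ℝ), Real.exp (-v) • F (Real.exp (-v)) := by
  rw [← image_exp_neg_Ioi, integral_image_eq_integral_abs_deriv_smul
    (f' := fun v => -Real.exp (-v)) measurableSet_Ioi
    (fun v _ => by
      have := ((hasDerivAt_id v).neg.exp).hasDerivWithinAt (s := Ioi (0 : ℝ))
      simpa using this)
    (fun a _ b _ h => by simpa using h)]
  simp only [abs_neg, abs_of_pos (Real.exp_pos _)]

theorem integral_gammaMeasure_eq {a r : ℝ} (ha : 0 < a) (hr : 0 < r) (F : ℝ → ℂ) :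
    ∫ v, F v ∂gammaMeasure a r
      = ∫ v in Ioi 0, (r ^ a / Real.Gamma a * v ^ (a - 1) * Real.exp (-(r * v))) • F v := by
  rw [gammaMeasure, integral_withDensity_eq_integral_toReal_smul (measurable_gammaPDF a r)
    (by simp [gammaPDF]), ← integral_indicator measurableSet_Ioi]
  refine integral_congr_ae ?_
  filter_upwards [Measure.ae_ne volume (0 : ℝ)] with v hv
  rcases lt_or_gt_of_ne hv with h | h
  · rw [gammaPDF_of_neg h, indicator_of_notMem (by simpa using h.le)]
    simp
  · have := Real.Gamma_pos_of_pos ha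
    rw [gammaPDF_of_nonneg h.le, indicator_of_mem (by simpa using h),
      ENNReal.toReal_ofReal (by positivity)]

/-- The rescaled Hölder mean is the average of the dilations over a gamma distribution. -/
theorem integral_dilate_gammaMeasure {t : ℝ} (ht : 0 < t) (f : ℝ → ℂ) (x : ℝ) :
    ∫ v, dilate v f x ∂gammaMeasure t (1 / 2) = (2 : ℝ) ^ (-t) • holderMean t f x := by
  rw [integral_gammaMeasure_eq ht (by norm_num), holderMean,
    setIntegral_Ioo_eq_setIntegral_exp_neg, ← integral_smul, ← integral_smul]
  refine setIntegral_congr_fun measurableSet_Ioi fun v _ => ?_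
  simp only [dilate, smul_smul, weight, one_div, ← Real.exp_neg, neg_neg, Real.log_exp]
  congr 1
  -- Half of the Jacobian makes the dilation isometric; the other half is the gamma exponential,
  -- which fixes the rate 1/2.
  have e : Real.exp (-v) = Real.exp (-(2⁻¹ * v)) * Real.exp (-v / 2) := by
    rw [← Real.exp_add]
    ring_nf
  rw [e, Real.inv_rpow zero_le_two, ← Real.rpow_neg zero_le_two]
  ring

theorem norm_inner_le_half_add_sq {E : Type*} [NormedAddCommGroup E] [InnerProductSpace ℂ E]
    (x y : E) :
    ‖inner ℂ x y‖ ≤ (‖x‖ ^ 2 + ‖y‖ ^ 2) / 2 := by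
  have := norm_inner_le_norm (𝕜 := ℂ) x y
  nlinarith [sq_nonneg (‖x‖ - ‖y‖)]

theorem integrable_norm_sq (f : L2R) : Integrable fun x => ‖f x‖ ^ 2 :=
  (memLp_two_iff_integrable_sq_norm (Lp.aestronglyMeasurable f)).1 (Lp.memLp f)

theorem integral_norm_sq (f : L2R) : ∫ x, ‖f x‖ ^ 2 = ‖f‖ ^ 2 := by
  have h := L2.inner_def (𝕜 := ℂ) f f
  simp only [inner_self_eq_norm_sq_to_K] at h
  have h2 := (integral_ofReal (𝕜 := ℂ) (f := fun x => ‖f x‖ ^ 2) (μ := volume)).symm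
  push_cast at h2
  have h3 := h2.trans h.symm
  exact_mod_cast h3

theorem integral_norm_inner_le (f g : L2R) :
    ∫ x, ‖inner ℂ (f x) (g x)‖ ≤ (‖f‖ ^ 2 + ‖g‖ ^ 2) / 2 := by
  rw [← integral_norm_sq, ← integral_norm_sq,
    ← integral_add (integrable_norm_sq f) (integrable_norm_sq g), ← integral_div]
  exact integral_mono_of_nonneg (Eventually.of_forall fun x => norm_nonneg _)
    (((integrable_norm_sq f).add (integrable_norm_sq g)).div_const 2)
    (Eventually.of_forall fun x => norm_inner_le_half_add_sq _ _)

theorem stronglyMeasurable_dilate_uncurry {f : ℝ → ℂ} (hf : StronglyMeasurable f) :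
    StronglyMeasurable fun p : ℝ × ℝ => dilate p.1 f p.2 := by
  have h1 : Measurable fun p : ℝ × ℝ => Real.exp (-p.1 / 2) := by fun_prop
  have h2 : Measurable fun p : ℝ × ℝ => Real.exp (-p.1) * p.2 := by fun_prop
  exact h1.stronglyMeasurable.smul (hf.comp_measurable h2)

theorem integrable_dilation (μ : Measure ℝ) [IsFiniteMeasure μ] (f : L2R) :
    Integrable (fun v => dilation v f) μ :=
  (integrable_const ‖f‖).mono' (continuous_dilation f).aestronglyMeasurable
    (Eventually.of_forall fun v => ((dilation v).norm_map f).le)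

/-- The hypothesis of Fubini in `T_apply_eq_integral`: since dilations are isometric, the L¹ norms
of the sections are bounded uniformly in v. -/
theorem integrable_inner_dilate (μ : Measure ℝ) [IsFiniteMeasure μ] (f g : L2R) :
    Integrable (fun p : ℝ × ℝ => inner ℂ (g p.2) (dilate p.1 f p.2)) (μ.prod volume) := by
  have hm : StronglyMeasurable fun p : ℝ × ℝ => inner ℂ (g p.2) (dilate p.1 f p.2) :=
    ((Lp.stronglyMeasurable g).comp_measurable measurable_snd).inner
      (stronglyMeasurable_dilate_uncurry (Lp.stronglyMeasurable f))
  have hae : ∀ v, (fun x => inner ℂ (g x) (dilation v f x))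
      =ᵐ[volume] fun x => inner ℂ (g x) (dilate v f x) := fun v => by
    filter_upwards [coeFn_dilation v f] with x hx
    rw [hx]
  rw [integrable_prod_iff hm.aestronglyMeasurable]
  refine ⟨Eventually.of_forall fun v =>
    (L2.integrable_inner (𝕜 := ℂ) g (dilation v f)).congr (hae v), ?_⟩
  refine (integrable_const ((‖g‖ ^ 2 + ‖f‖ ^ 2) / 2)).mono'
    hm.norm.integral_prod_right'.aestronglyMeasurable (Eventually.of_forall fun v => ?_)
  rw [Real.norm_of_nonneg (integral_nonneg fun x => norm_nonneg _),
    ← (dilation v).norm_map f]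
  refine le_trans (integral_congr_ae ?_).le (integral_norm_inner_le g (dilation v f))
  filter_upwards [hae v] with x hx
  rw [hx]

/-- The operator `T(t)` is the average of the dilations over a gamma distribution. -/
theorem T_apply_eq_integral {t : ℝ} (ht : 0 < t) (f : L2R) :
    T t f = ∫ v, dilation v f ∂gammaMeasure t (1 / 2) := by
  have := isProbabilityMeasure_gammaMeasure ht (r := 1 / 2) (by norm_num)
  -- Pairing with g avoids evaluating an L²-valued integral pointwise; scalar Fubini then suffices.
  refine ext_inner_left ℂ fun g => ?_
  rw [← integral_inner (integrable_dilation _ f)]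
  have h1 : ∀ v, inner ℂ g (dilation v f) = ∫ x, inner ℂ (g x) (dilate v f x) := fun v => by
    rw [L2.inner_def]
    refine integral_congr_ae ?_
    filter_upwards [coeFn_dilation v f] with x hx
    rw [hx]
  simp only [h1]
  rw [integral_integral_swap (integrable_inner_dilate _ f g), L2.inner_def]
  have hT : T t f =ᵐ[volume] fun x => (2 : ℝ) ^ (-t) • holderMean t f x := by
    refine (Lp.coeFn_smul ((2 : ℝ) ^ (-t)) (H t f)).trans ?_
    filter_upwards [coeFn_H ht f] with x hx
    rw [Pi.smul_apply, hx]
  refine integral_congr_ae ?_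
  filter_upwards [hT, (integrable_inner_dilate (gammaMeasure t (1 / 2)) f g).prod_left_ae]
    with x hx hi
  rw [hx, ← integral_dilate_gammaMeasure ht]
  -- Where g x ≠ 0, dividing by its conjugate recovers the integrability of the dilates at x.
  by_cases hg : g x = 0
  · simp [hg]
  · refine (integral_inner ?_ (g x)).symm
    have hne : (starRingEnd ℂ) (g x) ≠ 0 := (map_ne_zero _).2 hg
    refine (hi.mul_const ((starRingEnd ℂ) (g x))⁻¹).congr (Eventually.of_forall fun v => ?_)
    simp only [RCLike.inner_apply]
    rw [mul_assoc, mul_inv_cancel₀ hne, mul_one]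

/-! ### Contractivity, the semigroup law and strong continuity. -/

theorem T_zero : T 0 = ContinuousLinearMap.id ℂ L2R := by
  simp [T, H]

theorem norm_T_apply_le {t : ℝ} (ht : 0 ≤ t) (f : L2R) : ‖T t f‖ ≤ ‖f‖ := by
  rcases ht.eq_or_lt with rfl | ht
  · simp [T_zero]
  have := isProbabilityMeasure_gammaMeasure ht (r := 1 / 2) (by norm_num)
  rw [T_apply_eq_integral ht]
  refine (norm_integral_le_of_norm_le_const (C := ‖f‖)
    (Eventually.of_forall fun v => ((dilation v).norm_map f).le)).trans_eq ?_
  rw [probReal_univ, mul_one]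

theorem T_add_apply {s t : ℝ} (hs : 0 < s) (ht : 0 < t) (f : L2R) :
    T (s + t) f = T s (T t f) := by
  have := isProbabilityMeasure_gammaMeasure hs (r := 1 / 2) (by norm_num)
  have := isProbabilityMeasure_gammaMeasure ht (r := 1 / 2) (by norm_num)
  rw [T_apply_eq_integral (add_pos hs ht), T_apply_eq_integral hs, T_apply_eq_integral ht,
    ← gammaMeasure_conv_gammaMeasure hs ht (by norm_num), integral_conv (integrable_dilation _ f)]
  refine integral_congr_ae (Eventually.of_forall fun v => ?_)
  have h := ((dilation v).toContinuousLinearMap.restrictScalars ℝ).integral_comp_comm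
    (integrable_dilation (gammaMeasure t (1 / 2)) f)
  simp only [← dilation_dilation]
  exact h

theorem T_add {s t : ℝ} (hs : 0 ≤ s) (ht : 0 ≤ t) : T (s + t) = (T s).comp (T t) := by
  rcases hs.eq_or_lt with rfl | hs
  · rw [zero_add, T_zero, ContinuousLinearMap.id_comp]
  rcases ht.eq_or_lt with rfl | ht
  · rw [add_zero, T_zero, ContinuousLinearMap.comp_id]
  ext1 f
  exact T_add_apply hs ht f

/-- For s ≤ t the difference is T(s) applied to T(t - s)f - f. This reduces continuity everywhere to
continuity at 0. -/
theorem norm_T_apply_sub_le {s t : ℝ} (hs : 0 ≤ s) (ht : 0 ≤ t) (f : L2R) :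
    ‖T t f - T s f‖ ≤ ‖T |t - s| f - f‖ := by
  wlog h : s ≤ t generalizing s t
  · rw [norm_sub_rev, abs_sub_comm]
    exact this ht hs (le_of_not_ge h)
  have e : t = s + (t - s) := by ring
  rw [abs_of_nonneg (sub_nonneg.2 h)]
  nth_rewrite 1 [e]
  rw [T_add hs (sub_nonneg.2 h), ContinuousLinearMap.comp_apply, ← map_sub]
  exact norm_T_apply_le hs _

/-- A Markov-type bound: for v ≥ δ the integrand is at most 2‖f‖ ≤ (2‖f‖/δ)·v, and t / (1/2) is the
mean of v. -/
theorem norm_T_apply_sub_self_le {t δ ε : ℝ} (ht : 0 < t) (hδ : 0 < δ) (hε : 0 ≤ ε) (f : L2R)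
    (h : ∀ v, 0 < v → v < δ → ‖dilation v f - f‖ ≤ ε) :
    ‖T t f - f‖ ≤ ε + 2 * ‖f‖ / δ * (t / (1 / 2)) := by
  have := isProbabilityMeasure_gammaMeasure ht (r := 1 / 2) (by norm_num)
  have hid : Integrable (fun v : ℝ => v) (gammaMeasure t (1 / 2)) := by
    have := (integrable_mul_gammaMeasure ht (r := 1 / 2) (by norm_num)).const_mul (t / (1 / 2))
    refine this.congr (Eventually.of_forall fun v => ?_)
    field_simp
  have e : T t f - f = ∫ v, (dilation v f - f) ∂gammaMeasure t (1 / 2) := by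
    rw [integral_sub (integrable_dilation _ f) (integrable_const f), ← T_apply_eq_integral ht,
      integral_const, probReal_univ, one_smul]
  have hb : Integrable (fun v => ε + 2 * ‖f‖ / δ * v) (gammaMeasure t (1 / 2)) :=
    (integrable_const ε).add (hid.const_mul _)
  rw [e]
  refine (norm_integral_le_of_norm_le hb ?_).trans_eq ?_
  · filter_upwards [ae_pos_gammaMeasure t (1 / 2)] with v hv
    rcases lt_or_ge v δ with hvδ | hvδ
    · have : 0 ≤ 2 * ‖f‖ / δ * v := by positivity
      linarith [h v hv hvδ]
    · have h1 := norm_sub_le (dilation v f) f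
      rw [(dilation v).norm_map] at h1
      have h2 : 2 * ‖f‖ / δ * δ ≤ 2 * ‖f‖ / δ * v := by gcongr
      rw [div_mul_cancel₀ _ hδ.ne'] at h2
      linarith
  · rw [integral_add (integrable_const ε) (hid.const_mul _), integral_const_mul,
      integral_id_gammaMeasure ht (by norm_num), integral_const, probReal_univ, one_smul]

theorem tendsto_T_apply_zero (f : L2R) : Tendsto (fun t => T t f) (𝓝[≥] 0) (𝓝 f) := by
  rw [Metric.tendsto_nhds]
  intro ε hε
  obtain ⟨δ, hδ, hd⟩ := Metric.eventually_nhds_iff.1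
    ((Metric.tendsto_nhds.1 (tendsto_dilation_zero f)) (ε / 2) (by positivity))
  have hlim : Tendsto (fun t : ℝ => ε / 2 + 2 * ‖f‖ / δ * (t / (1 / 2))) (𝓝[≥] 0) (𝓝 (ε / 2)) := by
    have : Continuous fun t : ℝ => ε / 2 + 2 * ‖f‖ / δ * (t / (1 / 2)) := by fun_prop
    simpa using (this.tendsto 0).mono_left nhdsWithin_le_nhds
  filter_upwards [hlim.eventually_lt_const (half_lt_self hε), self_mem_nhdsWithin] with t h1 h2
  rcases (mem_Ici.1 h2).eq_or_lt with rfl | ht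
  · simpa [T_zero] using hε
  rw [dist_eq_norm]
  refine (norm_T_apply_sub_self_le ht hδ (by positivity) f fun v hv hvδ => ?_).trans_lt h1
  have := hd (y := v) (by simpa [abs_of_pos hv] using hvδ)
  rw [dist_eq_norm] at this
  exact this.le

theorem continuousOn_T_apply (f : L2R) : ContinuousOn (fun t => T t f) (Ici 0) := by
  intro s hs
  have h0 : Tendsto (fun t => |t - s|) (𝓝[Ici 0] s) (𝓝[≥] 0) := by
    refine tendsto_nhdsWithin_iff.2 ⟨?_, Eventually.of_forall fun t => mem_Ici.2 (abs_nonneg _)⟩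
    have : Continuous fun t : ℝ => |t - s| := by fun_prop
    have h := this.tendsto s
    simp only [sub_self, abs_zero] at h
    exact h.mono_left nhdsWithin_le_nhds
  have h1 := (tendsto_iff_norm_sub_tendsto_zero.1 (tendsto_T_apply_zero f)).comp
    h0
  rw [ContinuousWithinAt, tendsto_iff_norm_sub_tendsto_zero]
  refine squeeze_zero' (Eventually.of_forall fun t => norm_nonneg _) ?_ h1
  filter_upwards [self_mem_nhdsWithin] with t ht
  exact norm_T_apply_sub_le hs ht f

theorem isC0Semigroup_T : IsC0Semigroup T where
  zero := T_zero
  add _ _ hs ht := T_add hs ht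
  continuousOn := continuousOn_T_apply

/-! ### Uniform stability. -/

theorem norm_T_apply_sub_T_add_one_le {t : ℝ} (ht : 0 < t) (f : L2R) :
    ‖T t f - T (t + 1) f‖ ≤ 1 / √t * ‖f‖ := by
  have hr : (0 : ℝ) < 1 / 2 := by norm_num
  have := isProbabilityMeasure_gammaMeasure ht hr
  have := isProbabilityMeasure_gammaMeasure (add_pos ht one_pos) hr
  have hi : Integrable (fun v => (1 / 2 / t * v) • dilation v f) (gammaMeasure t (1 / 2)) :=
    (integrable_gammaMeasure_add_one_iff ht hr _).1 (integrable_dilation _ f)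
  have e : T t f - T (t + 1) f
      = ∫ v, (1 - 1 / 2 / t * v) • dilation v f ∂gammaMeasure t (1 / 2) := by
    rw [T_apply_eq_integral ht, T_apply_eq_integral (add_pos ht one_pos),
      integral_gammaMeasure_add_one ht hr, ← integral_sub (integrable_dilation _ f) hi]
    simp only [sub_smul, one_smul]
  rw [e]
  refine (norm_integral_le_integral_norm _).trans ?_
  simp only [norm_smul, (dilation _).norm_map, Real.norm_eq_abs]
  rw [integral_mul_const]
  exact mul_le_mul_of_nonneg_right (integral_abs_one_sub_gammaMeasure_le ht hr) (norm_nonneg f)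

theorem tendsto_T_apply_sub (f : L2R) : Tendsto (fun t => T t (f - T 1 f)) atTop (𝓝 0) := by
  have h : Tendsto (fun t : ℝ => 1 / √t * ‖f‖) atTop (𝓝 0) := by
    have := (tendsto_const_nhds (x := (1 : ℝ))).div_atTop Real.tendsto_sqrt_atTop
    simpa using this.mul_const ‖f‖
  refine squeeze_zero_norm' ?_ h
  filter_upwards [eventually_gt_atTop 0] with t ht
  rw [map_sub, ← T_add_apply ht one_pos]
  exact norm_T_apply_sub_T_add_one_le ht f

/-- The operator `T(1)` has no nonzero fixed vectors, even in the weak sense. -/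
theorem eq_zero_of_inner_T_one {g : L2R} (h : inner ℂ g (T 1 g) = inner ℂ g g) : g = 0 := by
  have hr : (0 : ℝ) < 1 / 2 := by norm_num
  have := isProbabilityMeasure_gammaMeasure one_pos hr
  have hint : Integrable (fun v => inner ℂ (dilation v g) g) (gammaMeasure 1 (1 / 2)) :=
    (integrable_dilation _ g).inner_const g
  have hre : ∫ v, (‖g‖ ^ 2 - RCLike.re (inner ℂ (dilation v g) g)) ∂gammaMeasure 1 (1 / 2) = 0 := by
    have h1 : ∫ v, inner ℂ g (dilation v g) ∂gammaMeasure 1 (1 / 2) = inner ℂ g g := by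
      rw [integral_inner (integrable_dilation _ g), ← T_apply_eq_integral one_pos, h]
    have h2 : ∫ v, RCLike.re (inner ℂ g (dilation v g)) ∂gammaMeasure 1 (1 / 2) = ‖g‖ ^ 2 := by
      rw [integral_re ((integrable_dilation _ g).const_inner g), h1, inner_self_eq_norm_sq]
    simp only [inner_re_symm _ g]
    rw [integral_sub (integrable_const _) ((integrable_dilation _ g).const_inner g).re, h2,
      integral_const, probReal_univ, one_smul, sub_self]
  have hle : ∀ v, RCLike.re (inner ℂ (dilation v g) g) ≤ ‖g‖ ^ 2 := fun v => by
    have := re_inner_le_norm (𝕜 := ℂ) (dilation v g) g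
    rwa [(dilation v).norm_map, ← sq] at this
  have hae := (integral_eq_zero_iff_of_nonneg (fun v => sub_nonneg.2 (hle v))
    ((integrable_const _).sub hint.re)).1 hre
  -- A nonnegative integrand with zero integral vanishes almost everywhere; a single v > 0 with
  -- equality in Cauchy–Schwarz gives a fixed vector of a nontrivial dilation.
  obtain ⟨v, hv, hv0⟩ := (hae.and (ae_pos_gammaMeasure 1 (1 / 2))).exists
  refine eq_zero_of_dilation_eq_self hv0
    (eq_of_norm_le_re_inner_eq_norm_sq (𝕜 := ℂ) ((dilation v).norm_map g).le ?_)
  exact (sub_eq_zero.1 hv).symm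

/-- A vector g orthogonal to the range need only be tested against its own image g - T(1)g. -/
theorem denseRange_sub_T_one : DenseRange fun f : L2R => f - T 1 f := by
  let A : L2R →L[ℂ] L2R := ContinuousLinearMap.id ℂ L2R - T 1
  have hA : (LinearMap.range A.toLinearMap)ᗮ = ⊥ := by
    refine (Submodule.eq_bot_iff _).2 fun g hg => eq_zero_of_inner_T_one ?_
    have := (Submodule.mem_orthogonal' _ _).1 hg (A g) ⟨g, rfl⟩
    have e : A g = g - T 1 g := rfl
    rw [e, inner_sub_right, sub_eq_zero] at this
    exact this.symm
  have h := Submodule.dense_iff_topologicalClosure_eq_top.2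
    ((Submodule.topologicalClosure_eq_top_iff).2 hA)
  exact h

theorem tendsto_T_apply_atTop (f : L2R) : Tendsto (fun t => T t f) atTop (𝓝 0) := by
  rw [Metric.tendsto_nhds]
  intro ε hε
  obtain ⟨g, hg⟩ := denseRange_sub_T_one.exists_dist_lt f (half_pos hε)
  filter_upwards [Metric.tendsto_nhds.1 (tendsto_T_apply_sub g) (ε / 2) (half_pos hε),
    eventually_ge_atTop 0] with t h1 h2
  have h3 := norm_T_apply_le h2 (f - (g - T 1 g))
  rw [dist_eq_norm] at hg
  rw [dist_zero_right] at h1 ⊢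
  have e : T t f = T t (f - (g - T 1 g)) + T t (g - T 1 g) := by
    rw [← map_add, sub_add_cancel]
  rw [e]
  linarith [norm_add_le (T t (f - (g - T 1 g))) (T t (g - T 1 g))]

theorem two_rpow_mul_norm_H_apply (t : ℝ) (f : L2R) : (2 : ℝ) ^ (-t) * ‖H t f‖ = ‖T t f‖ := by
  change _ = ‖(2 : ℝ) ^ (-t) • H t f‖
  rw [norm_smul, Real.norm_of_nonneg (by positivity)]

end HolderMeans

theorem mainTheorem11 :
    HolderMeans.IsC0Semigroup HolderMeans.T ∧
      ∀ f : HolderMeans.L2R,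
        Filter.Tendsto (fun t : ℝ => (2 : ℝ) ^ (-t) * ‖HolderMeans.H t f‖) Filter.atTop (nhds 0) := by
  refine ⟨HolderMeans.isC0Semigroup_T, fun f => ?_⟩
  simp only [HolderMeans.two_rpow_mul_norm_H_apply]
  simpa using (HolderMeans.tendsto_T_apply_atTop f).norm
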